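/- Let $S_\infty$ be the group of all permutations of $\mathbb{N}$, equipped with the topology of pointwise convergence. For a standard probability space $(X,\mu)$, denote by $\operatorname{Aut}_{\mathrm{mp}}(X,\mu)$ the group of measure preserving automorphisms of $(X,\mu)$, identifying two automorphisms that coincide almost everywhere, with its usual Polish topology, in which $\alpha_i \to \alpha$ if and only if $\mu(\alpha_i^{-1}(A) \mathbin{\triangle} \alpha^{-1}(A)) \to 0$ for every measurable $A \subset X$. A Polish group $G$ is called a centralizer group if there exist a standard probability space $(X,\mu)$ and an ergodic probability measure preserving action $\Lambda \curvearrowright (X,\mu)$ of a countable group $\Lambda$ such that $G$ is isomorphic, as a topological group, to the centralizer of (the image of) $\Lambda$ inside $\operatorname{Aut}_{\mathrm{mp}}(X,\mu)$. Theorem. Every closed subgroup $G$ of $S_\infty$ (with the subspace topology) is a Polish group and is a centralizer group. -/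

import Mathlib

open MeasureTheory
open scoped symmDiff ENNReal

/-- The group `S_∞` of all permutations of `ℕ`. -/
abbrev SInfty : Type := Equiv.Perm ℕ

/-- The topology of pointwise convergence on `S_∞`, with `ℕ` discrete. -/
instance SInfty.instTopologicalSpace : TopologicalSpace SInfty :=
  TopologicalSpace.induced (fun (σ : SInfty) (n : ℕ) => σ n) inferInstance

section Automorphisms

variable {X : Type*} [MeasurableSpace X]

/-- The measure preserving bijections of `(X, μ)` with measurable inverse, as a group under
composition. -/
def mpPerm (μ : Measure X) : Subgroup (Equiv.Perm X) where
  carrier := {e | MeasurePreserving e μ μ ∧ MeasurePreserving e.symm μ μ}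
  mul_mem' := fun ha hb => ⟨ha.1.comp hb.1, hb.2.comp ha.2⟩
  one_mem' := ⟨MeasurePreserving.id μ, MeasurePreserving.id μ⟩
  inv_mem' := fun ha => ⟨ha.2, ha.1⟩

/-- The automorphisms that coincide with the identity almost everywhere. -/
def aeTrivial (μ : Measure X) : Subgroup (mpPerm μ) where
  carrier := {e | ∀ᵐ x ∂μ, (e : Equiv.Perm X) x = x}
  mul_mem' := by
    intro a b ha hb
    filter_upwards [hb, b.2.1.quasiMeasurePreserving.ae ha] with x hx hx'
    exact hx'.trans hx
  one_mem' := show ∀ᵐ x ∂μ, ((1 : mpPerm μ) : Equiv.Perm X) x = x from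
    Filter.Eventually.of_forall fun _ => rfl
  inv_mem' := by
    intro a ha
    filter_upwards [a.2.2.quasiMeasurePreserving.ae ha] with x hx
    have h : (a : Equiv.Perm X) ((a : Equiv.Perm X).symm x) = x := Equiv.apply_symm_apply _ _
    exact hx.symm.trans h

instance aeTrivial_normal (μ : Measure X) : (aeTrivial μ).Normal where
  conj_mem := by
    intro a ha g
    filter_upwards [g.2.2.quasiMeasurePreserving.ae ha] with x hx
    have h : (g : Equiv.Perm X) ((g : Equiv.Perm X).symm x) = x := Equiv.apply_symm_apply _ _
    exact (congrArg (g : Equiv.Perm X) hx).trans h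

/-- `Aut_mp(X, μ)`: measure preserving automorphisms of `(X, μ)`, two of them being identified
when they coincide almost everywhere. -/
def AutMP (μ : Measure X) : Type _ := mpPerm μ ⧸ aeTrivial μ

instance AutMP.instGroup (μ : Measure X) : Group (AutMP μ) :=
  inferInstanceAs (Group (mpPerm μ ⧸ aeTrivial μ))

/-- The class of an automorphism in `Aut_mp(X, μ)`. -/
def AutMP.mk (μ : Measure X) : mpPerm μ →* AutMP μ := QuotientGroup.mk' (aeTrivial μ)

theorem AutMP.mk_eq_mk_iff (μ : Measure X) (a b : mpPerm μ) :
    AutMP.mk μ a = AutMP.mk μ b ↔ ∀ᵐ x ∂μ, (a : Equiv.Perm X) x = (b : Equiv.Perm X) x := by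
  refine (QuotientGroup.eq (s := aeTrivial μ)).trans ⟨fun h => ?_, fun h => ?_⟩
  · filter_upwards [(show ∀ᵐ x ∂μ, (a : Equiv.Perm X).symm ((b : Equiv.Perm X) x) = x from h)]
      with x hx
    exact ((Equiv.symm_apply_eq _).1 hx).symm
  · refine (show ∀ᵐ x ∂μ, (a : Equiv.Perm X).symm ((b : Equiv.Perm X) x) = x from ?_)
    filter_upwards [h] with x hx
    exact (Equiv.symm_apply_eq _).2 hx.symm

/-- The number `μ (α⁻¹(A) ∆ B)`, which depends only on the class of `α`. -/
def AutMP.measureSymmDiff (μ : Measure X) (A B : Set X) : AutMP μ → ℝ≥0∞ :=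
  Quotient.lift (fun e : mpPerm μ => μ (((e : Equiv.Perm X) ⁻¹' A) ∆ B)) (by
    intro a b hab
    have h := (AutMP.mk_eq_mk_iff μ a b).1 (Quotient.sound hab)
    refine measure_congr ?_
    filter_upwards [h] with x hx
    have hA : (((a : Equiv.Perm X) ⁻¹' A) x) = (((b : Equiv.Perm X) ⁻¹' A) x) :=
      congrArg A hx
    exact congrArg (fun p : Prop => (p ∧ ¬ B x) ∨ (B x ∧ ¬ p)) hA)

/-- The usual (weak) topology on `Aut_mp(X, μ)`: the coarsest one for which
`α ↦ μ (α⁻¹(A) ∆ B)` is continuous for all measurable `A` and `B`. A net `αᵢ` converges to `α`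
exactly when `μ (αᵢ⁻¹(A) ∆ α⁻¹(A)) → 0` for every measurable set `A`. -/
instance AutMP.instTopologicalSpace (μ : Measure X) : TopologicalSpace (AutMP μ) :=
  ⨅ (A : {A : Set X // MeasurableSet A}) (B : {B : Set X // MeasurableSet B}),
    TopologicalSpace.induced (AutMP.measureSymmDiff μ A.1 B.1) inferInstance

/-- The homomorphism `Λ → Aut_mp(X, μ)` given by a measure preserving action of `Λ`. -/
def AutMP.ofAction (Λ : Type*) [Group Λ] [MulAction Λ X] [MeasurableConstSMul Λ X]
    (μ : Measure X) [SMulInvariantMeasure Λ X μ] : Λ →* AutMP μ :=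
  (AutMP.mk μ).comp ((MulAction.toPermHom Λ X).codRestrict (mpPerm μ)
    fun g => ⟨measurePreserving_smul g μ, measurePreserving_smul g⁻¹ μ⟩)

end Automorphisms

/-- A topological group `G` is a centralizer group if it is Polish and there is an ergodic
probability measure preserving action of a countable group `Λ` on a standard probability space
`(X, μ)` such that `G` is isomorphic, as a topological group, with the centralizer of `Λ` inside
`Aut_mp(X, μ)`. -/
def IsCentralizerGroup (G : Type*) [Group G] [TopologicalSpace G] : Prop :=
  IsTopologicalGroup G ∧ PolishSpace G ∧
    ∃ (X : Type) (_ : MeasurableSpace X) (_ : StandardBorelSpace X)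
      (μ : Measure X) (_ : IsProbabilityMeasure μ)
      (Λ : Type) (_ : Group Λ) (_ : Countable Λ)
      (_ : MulAction Λ X) (_ : MeasurableConstSMul Λ X) (_ : ErgodicSMul Λ X μ),
      Nonempty (G ≃ₜ* Subgroup.centralizer ((AutMP.ofAction Λ μ).range : Set (AutMP μ)))

/-! ### Measures on powers of the Cantor group invariant under diagonal prefix permutations. -/

section CantorPowers

/-! The group `G` acts on the countable set `PointList` of points and finite lists, hence by
permuting coordinates on `PointList → Cantor` with Haar measure. `Λ` is generated by two countable
families commuting with this action. The diagonal prefix permutations apply one permutation of the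
first `N` digits in every coordinate. The shears add to coordinate `s`, for each list `s` in the
`G`-orbit of `t`, the coordinate of the point that is the `l`-th entry of `s`.

Prefix permutations are transitive on tuples of distinct prefixes, so a finite invariant measure on
a power of `Cantor` that does not charge the diagonals is a multiple of Haar
(`measure_smul_eq_of_diag_invariant`). Restricting Haar measure to an invariant set gives
ergodicity. Adjoining an equivariant map to `Cantor` as a new coordinate shows that it is a
coordinate projection (`exists_ae_eq_coord_of_equivariant`). An element of the centralizer is thus a
substitution of coordinates `x ↦ x ∘ ρ`.

Commuting with the shears makes `ρ` respect entries of lists in `G`-orbits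
(`map_eq_of_commute_shear`). So `ρ` comes from a permutation of `ℕ` agreeing on each finite list
with some element of `G`, and closedness puts it in `G` (`exists_mem_of_commute_orbitEntry`). The
resulting isomorphism is continuous because the action on the compact space is jointly continuous,
and open because distinct coordinates are independent (`cantorHaar_zeroDigit_symmDiff_lt`). -/

/-- The Cantor group `(ℤ/2)^ℕ`. -/
abbrev Cantor : Type := ℕ → ZMod 2

/-- The permutation of the Cantor group that permutes the blocks of the first `N` digits. -/
def prefixPerm (N : ℕ) (g : Equiv.Perm (Fin N → ZMod 2)) : Equiv.Perm Cantor where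
  toFun x n := if h : n < N then g (fun i => x i) ⟨n, h⟩ else x n
  invFun x n := if h : n < N then g.symm (fun i => x i) ⟨n, h⟩ else x n
  left_inv x := by
    funext n
    by_cases h : n < N <;> simp [h]
  right_inv x := by
    funext n
    by_cases h : n < N <;> simp [h]

theorem prefixPerm_prefix (N : ℕ) (g : Equiv.Perm (Fin N → ZMod 2)) (x : Cantor) :
    (fun i : Fin N => prefixPerm N g x i) = g (fun i => x i) := by
  funext i
  simp [prefixPerm]

theorem measurable_prefixPerm (N : ℕ) (g : Equiv.Perm (Fin N → ZMod 2)) :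
    Measurable (prefixPerm N g) := by
  refine measurable_pi_lambda _ fun n => ?_
  by_cases h : n < N
  · simp only [prefixPerm, Equiv.coe_fn_mk, h, dif_pos]
    exact (measurable_pi_apply _).comp
      ((measurable_of_finite g).comp (measurable_pi_lambda _ fun i => measurable_pi_apply _))
  · simp only [prefixPerm, Equiv.coe_fn_mk, h, dif_neg, not_false_eq_true]
    exact measurable_pi_apply _

variable {E : Type*}

/-- The diagonal action of a prefix permutation on a power of the Cantor group. -/
def diagPerm (E : Type*) (N : ℕ) (g : Equiv.Perm (Fin N → ZMod 2)) :
    Equiv.Perm (E → Cantor) :=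
  Equiv.piCongrRight fun _ => prefixPerm N g

@[simp]
theorem diagPerm_apply (N : ℕ) (g : Equiv.Perm (Fin N → ZMod 2)) (x : E → Cantor) (e : E) :
    diagPerm E N g x e = prefixPerm N g (x e) := rfl

theorem measurable_diagPerm (N : ℕ) (g : Equiv.Perm (Fin N → ZMod 2)) :
    Measurable (diagPerm E N g) :=
  measurable_pi_lambda _ fun e => (measurable_prefixPerm N g).comp (measurable_pi_apply e)

/-- The first `N` digits of the coordinates in `S`. -/
def digits (S : Finset E) (N : ℕ) (x : E → Cantor) : S → Fin N → ZMod 2 :=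
  fun e i => x e i

theorem measurable_digits (S : Finset E) (N : ℕ) : Measurable (digits S N) :=
  measurable_pi_lambda _ fun e => measurable_pi_lambda _ fun i =>
    (measurable_pi_apply (i : ℕ)).comp (measurable_pi_apply (e : E))

theorem digits_diagPerm (S : Finset E) (N : ℕ) (g : Equiv.Perm (Fin N → ZMod 2))
    (x : E → Cantor) : digits S N (diagPerm E N g x) = fun e => g (digits S N x e) := by
  funext e
  exact prefixPerm_prefix N g (x e)

/-- The sets that depend on finitely many digits of finitely many coordinates. -/
def digitCylinders (E : Type*) : Set (Set (E → Cantor)) :=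
  {B | ∃ (S : Finset E) (N : ℕ), ∀ M ≥ N, ∃ b : Set (S → Fin M → ZMod 2), B = digits S M ⁻¹' b}

theorem mem_digitCylinders_of_forall {B : Set (E → Cantor)} (S : Finset E) (N : ℕ)
    (h : ∀ x y : E → Cantor, (∀ e ∈ S, ∀ n < N, x e n = y e n) → x ∈ B → y ∈ B) :
    B ∈ digitCylinders E := by
  refine ⟨S, N, fun M hM => ⟨digits S M '' B, ?_⟩⟩
  ext y
  refine ⟨fun hy => ⟨y, hy, rfl⟩, ?_⟩
  rintro ⟨x, hx, hxy⟩
  refine h x y (fun e he n hn => ?_) hx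
  exact congrFun (congrFun hxy ⟨e, he⟩) ⟨n, hn.trans_le hM⟩

theorem forall_of_mem_digitCylinders {B : Set (E → Cantor)} (hB : B ∈ digitCylinders E) :
    ∃ (S : Finset E) (N : ℕ), ∀ x y : E → Cantor,
      (∀ e ∈ S, ∀ n < N, x e n = y e n) → x ∈ B → y ∈ B := by
  obtain ⟨S, N, h⟩ := hB
  obtain ⟨b, rfl⟩ := h N le_rfl
  refine ⟨S, N, fun x y hxy hx => ?_⟩
  have : digits S N x = digits S N y := by
    funext e i
    exact hxy e e.2 i i.2
  simpa [← this] using hx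

theorem isPiSystem_digitCylinders : IsPiSystem (digitCylinders E) := by
  classical
  intro B hB C hC _
  obtain ⟨S, N, hB⟩ := forall_of_mem_digitCylinders hB
  obtain ⟨T, M, hC⟩ := forall_of_mem_digitCylinders hC
  refine mem_digitCylinders_of_forall (S ∪ T) (max N M) fun x y hxy hx => ⟨?_, ?_⟩
  · exact hB x y (fun e he n hn => hxy e (Finset.mem_union_left _ he) n (lt_max_of_lt_left hn)) hx.1
  · exact hC x y (fun e he n hn => hxy e (Finset.mem_union_right _ he) n (lt_max_of_lt_right hn))
      hx.2

theorem generateFrom_digitCylinders :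
    (inferInstance : MeasurableSpace (E → Cantor)) =
      MeasurableSpace.generateFrom (digitCylinders E) := by
  refine le_antisymm ?_ (MeasurableSpace.generateFrom_le ?_)
  · refine iSup_le fun e => ?_
    rw [MeasurableSpace.comap_le_iff_le_map]
    refine iSup_le fun n => ?_
    rw [MeasurableSpace.comap_le_iff_le_map]
    intro s _
    refine MeasurableSpace.measurableSet_generateFrom
      (mem_digitCylinders_of_forall {e} (n + 1) fun x y hxy hx => ?_)
    have := hxy e (Finset.mem_singleton_self e) n (Nat.lt_succ_self n)
    simpa [Set.mem_preimage, this] using hx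
  · rintro B ⟨S, N, h⟩
    obtain ⟨b, rfl⟩ := h N le_rfl
    exact measurable_digits S N (Set.toFinite b).measurableSet

/-- A finite measure is determined by its values on the atoms of the digit cylinders. -/
theorem measure_ext_of_digits {m m' : Measure (E → Cantor)} [IsFiniteMeasure m]
    (N₀ : ℕ) (h : ∀ (S : Finset E) (N : ℕ), N₀ ≤ N → ∀ b : S → Fin N → ZMod 2,
      m (digits S N ⁻¹' {b}) = m' (digits S N ⁻¹' {b})) : m = m' := by
  have key : ∀ (S : Finset E) (N : ℕ), N₀ ≤ N → ∀ b : Set (S → Fin N → ZMod 2),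
      m (digits S N ⁻¹' b) = m' (digits S N ⁻¹' b) := by
    intro S N hN b
    have hm : ∀ a ∈ b.toFinite.toFinset, MeasurableSet (digits S N ⁻¹' {a}) :=
      fun a _ => measurable_digits S N (measurableSet_singleton a)
    have h1 := sum_measure_preimage_singleton (μ := m) b.toFinite.toFinset hm
    have h2 := sum_measure_preimage_singleton (μ := m') b.toFinite.toFinset hm
    rw [Set.Finite.coe_toFinset] at h1 h2
    rw [← h1, ← h2]
    exact Finset.sum_congr rfl fun a _ => h S N hN a
  refine ext_of_generate_finite _ generateFrom_digitCylinders isPiSystem_digitCylinders ?_ ?_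
  · rintro B ⟨S, N, hB⟩
    -- A cylinder can be read at any deeper level, so short prefixes may be ignored.
    obtain ⟨b, rfl⟩ := hB (max N N₀) (le_max_left _ _)
    exact key S _ (le_max_right _ _) b
  · exact key ∅ N₀ le_rfl Set.univ

/-- A measure invariant under diagonal prefix permutations gives the same mass to all tuples of
pairwise distinct prefixes. -/
theorem measure_digits_eq_of_injective {m : Measure (E → Cantor)}
    (hm : ∀ N g, MeasurePreserving (diagPerm E N g) m m) (S : Finset E) (N : ℕ)
    {a b : S → Fin N → ZMod 2} (ha : a.Injective) (hb : b.Injective) :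
    m (digits S N ⁻¹' {a}) = m (digits S N ⁻¹' {b}) := by
  obtain ⟨g, hg⟩ := Equiv.Perm.exists_extending_pair a b ha hb
  rw [← (hm N g).measure_preimage
    (measurable_digits S N (measurableSet_singleton b)).nullMeasurableSet]
  congr 1
  ext x
  simp only [Set.mem_preimage, Set.mem_singleton_iff, digits_diagPerm]
  constructor
  · intro h
    funext e
    rw [h, hg]
  · intro h
    funext e
    apply g.injective
    rw [hg, ← h]

/-- Transitivity on injective tuples makes `m` a multiple `c` of counting measure there. If the
prefixes are too short for injective tuples to exist, `c = 0` serves. -/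
theorem measure_digits_inter_injective {m : Measure (E → Cantor)}
    (hm : ∀ N g, MeasurePreserving (diagPerm E N g) m m) (S : Finset E) (N : ℕ) :
    ∃ c : ℝ≥0∞, ∀ b : Set (S → Fin N → ZMod 2),
      m (digits S N ⁻¹' (b ∩ {a | a.Injective})) = (b ∩ {a | a.Injective}).ncard * c := by
  classical
  by_cases hne : ∃ a₀ : S → Fin N → ZMod 2, a₀.Injective
  · obtain ⟨a₀, ha₀⟩ := hne
    refine ⟨m (digits S N ⁻¹' {a₀}), fun b => ?_⟩
    have hfin : (b ∩ {a | a.Injective}).Finite := Set.toFinite _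
    have h1 := sum_measure_preimage_singleton (μ := m) hfin.toFinset
      (fun a _ => measurable_digits S N (measurableSet_singleton a))
    rw [Set.Finite.coe_toFinset] at h1
    rw [← h1, Finset.sum_congr rfl fun a ha =>
      measure_digits_eq_of_injective hm S N (((Set.Finite.mem_toFinset _).1 ha).2) ha₀,
      Finset.sum_const, nsmul_eq_mul, Set.ncard_eq_toFinset_card _ hfin]
  · refine ⟨0, fun b => ?_⟩
    have : b ∩ {a : S → Fin N → ZMod 2 | a.Injective} = ∅ := by
      ext a
      simp only [Set.mem_inter_iff, Set.mem_ofPred_eq, Set.mem_empty_iff_false, iff_false, not_and]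
      exact fun _ ha => hne ⟨a, ha⟩
    simp [this]

/-- Almost surely the finitely many coordinates in `S` are distinct, hence already separated by
prefixes of some finite length. The sets increase with `N`, so continuity from below applies. -/
theorem tendsto_measure_digits_injective {m : Measure (E → Cantor)}
    (hd : ∀ e e', e ≠ e' → m {x | x e = x e'} = 0) (S : Finset E) (B : Set (E → Cantor)) :
    Filter.Tendsto (fun N => m (B ∩ digits S N ⁻¹' {a | a.Injective})) Filter.atTop
      (nhds (m B)) := by
  have hmono : Monotone fun N => B ∩ digits S N ⁻¹' {a | a.Injective} := by
    intro N M hNM x hx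
    refine ⟨hx.1, fun e e' h => hx.2 (funext fun i => ?_)⟩
    exact congrFun h (Fin.castLE hNM i)
  have hB : m (⋃ N, B ∩ digits S N ⁻¹' {a | a.Injective}) = m B := by
    rw [← Set.inter_iUnion]
    refine measure_congr (Filter.eventuallyEq_set.2 ?_)
    have : ∀ᵐ x ∂m, ∀ e e' : S, e ≠ e' → x e ≠ x e' := by
      refine ae_all_iff.2 fun e => ae_all_iff.2 fun e' => ?_
      by_cases h : e = e'
      · simp [h]
      · have h0 := hd e e' (fun h' => h (Subtype.ext h'))
        filter_upwards [measure_eq_zero_iff_ae_notMem.1 h0] with x hx _ using hx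
    filter_upwards [this] with x hx
    have hsep : ∀ p : S × S, ∃ n, p.1 ≠ p.2 → x p.1 n ≠ x p.2 n := by
      intro p
      by_cases h : p.1 = p.2
      · exact ⟨0, fun h' => absurd h h'⟩
      · obtain ⟨n, hn⟩ := Function.ne_iff.1 (hx p.1 p.2 h)
        exact ⟨n, fun _ => hn⟩
    choose n hn using hsep
    refine ⟨fun h => h.1, fun hxB => ⟨hxB, ?_⟩⟩
    refine Set.mem_iUnion.2 ⟨Finset.univ.sup n + 1, fun e e' h => ?_⟩
    by_contra hne
    refine hn (e, e') hne (congrFun h ⟨n (e, e'), Nat.lt_succ_of_le ?_⟩)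
    exact Finset.le_sup (f := n) (Finset.mem_univ (e, e'))
  rw [← hB]
  exact tendsto_measure_iUnion_atTop hmono

/-- Up to scaling, there is only one finite measure on a power of the Cantor group that is
invariant under diagonal prefix permutations and gives no mass to the diagonals. -/
theorem measure_smul_eq_of_diag_invariant {m m' : Measure (E → Cantor)} [IsFiniteMeasure m]
    [IsFiniteMeasure m'] (hm : ∀ N g, MeasurePreserving (diagPerm E N g) m m)
    (hm' : ∀ N g, MeasurePreserving (diagPerm E N g) m' m')
    (hd : ∀ e e', e ≠ e' → m {x | x e = x e'} = 0)
    (hd' : ∀ e e', e ≠ e' → m' {x | x e = x e'} = 0) :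
    m' Set.univ • m = m Set.univ • m' := by
  have hf : ∀ (c : ℝ≥0∞) (ν : Measure (E → Cantor)) [IsFiniteMeasure ν], c ≠ ∞ →
      IsFiniteMeasure (c • ν) := fun c ν _ hc =>
    ⟨by simpa using ENNReal.mul_lt_top hc.lt_top (measure_lt_top ν _)⟩
  have := hf _ m (measure_ne_top m' Set.univ)
  refine measure_ext_of_digits 0 fun S N _ b => ?_
  simp only [Measure.smul_apply, smul_eq_mul]
  set B := digits S N ⁻¹' {b} with hB
  -- On injective level-`M` tuples both measures are multiples of counting measure, so they are
  -- proportional there; the cross-multiplied form avoids division and survives the limit in `M`.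
  have hlev : ∀ M ≥ N,
      m' (Set.univ ∩ digits S M ⁻¹' {a | a.Injective}) * m (B ∩ digits S M ⁻¹' {a | a.Injective}) =
      m (Set.univ ∩ digits S M ⁻¹' {a | a.Injective}) *
        m' (B ∩ digits S M ⁻¹' {a | a.Injective}) := by
    intro M hM
    have hBM : B = digits S M ⁻¹' {a | (fun e (i : Fin N) => a e (Fin.castLE hM i)) = b} := rfl
    obtain ⟨c, hc⟩ := measure_digits_inter_injective hm S M
    obtain ⟨c', hc'⟩ := measure_digits_inter_injective hm' S M
    rw [hBM, ← Set.preimage_univ (f := digits S M), ← Set.preimage_inter, ← Set.preimage_inter,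
      hc, hc, hc', hc']
    ring
  have l1 := ENNReal.Tendsto.mul (tendsto_measure_digits_injective hd' S Set.univ)
    (Or.inr (measure_ne_top m B)) (tendsto_measure_digits_injective hd S B)
    (Or.inr (measure_ne_top m' Set.univ))
  have l2 := ENNReal.Tendsto.mul (tendsto_measure_digits_injective hd S Set.univ)
    (Or.inr (measure_ne_top m' B)) (tendsto_measure_digits_injective hd' S B)
    (Or.inr (measure_ne_top m Set.univ))
  refine tendsto_nhds_unique (l1.congr' ?_) l2
  filter_upwards [Filter.eventually_ge_atTop N] with M hM using hlev M hM

end CantorPowers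

/-! ### Haar measure: ergodicity and equivariant maps. -/

section CantorHaar

variable {E : Type*} [Countable E]

/-- The Haar probability measure on a countable power of the Cantor group. -/
noncomputable def cantorHaar (E : Type*) [Countable E] : Measure (E → Cantor) :=
  Measure.addHaarMeasure ⊤

instance : (cantorHaar E).IsAddHaarMeasure :=
  inferInstanceAs (Measure.addHaarMeasure ⊤).IsAddHaarMeasure

instance : IsProbabilityMeasure (cantorHaar E) where
  measure_univ := by
    simpa [cantorHaar] using
      Measure.addHaarMeasure_self (K₀ := (⊤ : TopologicalSpace.PositiveCompacts (E → Cantor)))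

theorem measurePreserving_cantorHaar {F : Type*} [Countable F] (f : (E → Cantor) →+ (F → Cantor))
    (hf : Continuous f) (hs : Function.Surjective f) :
    MeasurePreserving f (cantorHaar E) (cantorHaar F) :=
  AddMonoidHom.measurePreserving hf hs (by simp)

/-- Translation by `b - a`, extended by zero, carries one cylinder to the other. -/
theorem cantorHaar_digits_eq (S : Finset E) (N : ℕ) (a b : S → Fin N → ZMod 2) :
    cantorHaar E (digits S N ⁻¹' {a}) = cantorHaar E (digits S N ⁻¹' {b}) := by
  classical
  let t : E → Cantor := fun e n =>
    if h : e ∈ S ∧ n < N then b ⟨e, h.1⟩ ⟨n, h.2⟩ - a ⟨e, h.1⟩ ⟨n, h.2⟩ else 0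
  rw [← measure_preimage_add (cantorHaar E) t (digits S N ⁻¹' {b})]
  congr 1
  ext x
  have : digits S N (t + x) = fun e i => b e i - a e i + digits S N x e i := by
    funext e i
    simp [digits, t]
  simp only [Set.mem_preimage, Set.mem_singleton_iff, this]
  constructor
  · rintro rfl
    simp
  · intro h
    funext e i
    have := congrFun (congrFun h e) i
    linear_combination this

/-- For `M ≥ N` the preimage of a level-`M` atom is again a level-`M` atom, and Haar measure gives
all of these the same mass. -/
theorem measurePreserving_diagPerm (N : ℕ) (g : Equiv.Perm (Fin N → ZMod 2)) :
    MeasurePreserving (diagPerm E N g) (cantorHaar E) (cantorHaar E) := by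
  refine ⟨measurable_diagPerm N g, ?_⟩
  have := Measure.isFiniteMeasure_map (cantorHaar E) (diagPerm E N g)
  refine measure_ext_of_digits N fun S M hM b => ?_
  rw [Measure.map_apply (measurable_diagPerm N g)
    (measurable_digits S M (measurableSet_singleton b))]
  -- a prefix permutation permutes the longer prefixes as well
  let c : S → Fin M → ZMod 2 := fun e i =>
    if h : (i : ℕ) < N then g.symm (fun k => b e (Fin.castLE hM k)) ⟨i, h⟩ else b e i
  rw [cantorHaar_digits_eq S M b c]
  congr 1
  ext x
  simp only [Set.mem_preimage, Set.mem_singleton_iff]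
  constructor
  · rintro rfl
    funext e i
    by_cases h : (i : ℕ) < N
    · have := prefixPerm_prefix N g (x e)
      simp only [c, h, dif_pos, digits, diagPerm_apply, Fin.val_castLE]
      rw [this]
      simp
    · simp [c, h, digits, prefixPerm]
  · intro h
    have hc : ∀ (e : S) (i : Fin M), x e i = c e i := fun e i => congrFun (congrFun h e) i
    funext e i
    by_cases hi : (i : ℕ) < N
    · have : (fun k : Fin N => x e k) = g.symm (fun k => b e (Fin.castLE hM k)) := by
        funext k
        have := hc e (Fin.castLE hM k)
        simpa [c] using this
      simp [digits, prefixPerm, hi, this]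
    · have := hc e i
      simpa [digits, prefixPerm, hi, c] using this

/-- The graph of a function that does not depend on the coordinate `e` is null. -/
theorem cantorHaar_graph_eq_zero (e : E) (F : (E → Cantor) → Cantor)
    (hF : Measurable F)
    (hFe : ∀ x y, (∀ e', e' ≠ e → x e' = y e') → F x = F y) :
    cantorHaar E {x | x e = F x} = 0 := by
  classical
  -- Translation by `t n` flips digit `n` of coordinate `e`, which `F` does not see. The translates
  -- of the graph are disjoint and of equal mass, and there are infinitely many.
  let t : ℕ → E → Cantor := fun n => Pi.single e (Pi.single n 1)
  let A : ℕ → Set (E → Cantor) := fun n => (fun x => t n + x) ⁻¹' {x | x e = F x}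
  have hmeas : MeasurableSet {x : E → Cantor | x e = F x} :=
    measurableSet_eq_fun (measurable_pi_apply e) hF
  have hA : ∀ n, cantorHaar E (A n) = cantorHaar E {x | x e = F x} := fun n =>
    measure_preimage_add (cantorHaar E) (t n) _
  have hmem : ∀ n x, x ∈ A n → (Pi.single n 1 : Cantor) + x e = F x := by
    intro n x hx
    have h : (t n + x) e = F (t n + x) := hx
    rw [hFe (t n + x) x fun e' he' => by simp [t, he']] at h
    simpa [t] using h
  have hdis : Pairwise (Function.onFun Disjoint A) := by
    intro n k hnk
    refine Set.disjoint_left.2 fun x hn hk => ?_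
    have h := (hmem n x hn).trans (hmem k x hk).symm
    have := congrFun (add_right_cancel h) n
    simp [hnk] at this
  by_contra hne
  have h1 := measure_iUnion (μ := cantorHaar E) hdis
    fun n => hmeas.preimage (measurable_const_add (t n))
  simp only [hA] at h1
  rw [ENNReal.tsum_const_eq_top_of_ne_zero hne] at h1
  exact measure_ne_top _ _ h1

theorem cantorHaar_diagonal_eq_zero {e e' : E} (h : e ≠ e') :
    cantorHaar E {x | x e = x e'} = 0 :=
  cantorHaar_graph_eq_zero e (fun x => x e') (measurable_pi_apply e')
    fun _ _ hxy => hxy e' h.symm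

theorem eq_of_ae_eq_coord {e e' : E} (h : ∀ᵐ x ∂cantorHaar E, x e = x e') : e = e' := by
  by_contra hne
  have h0 := measure_eq_zero_iff_ae_notMem.1 (cantorHaar_diagonal_eq_zero hne)
  obtain ⟨x, hx, hx'⟩ := (h.and h0).exists
  exact hx' hx

theorem not_ae_coord_eq_zero (e : E) : ¬ ∀ᵐ x ∂cantorHaar E, x e = 0 := by
  intro h
  have h0 := measure_eq_zero_iff_ae_notMem.1
    (cantorHaar_graph_eq_zero e (fun _ => 0) measurable_const fun _ _ _ => rfl)
  obtain ⟨x, hx, hx'⟩ := (h.and h0).exists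
  exact hx' hx

/-- The diagonal action of the prefix permutations is ergodic. -/
theorem eventuallyConst_of_diagPerm_invariant {s : Set (E → Cantor)} (hs : MeasurableSet s)
    (h : ∀ N g, diagPerm E N g ⁻¹' s =ᵐ[cantorHaar E] s) :
    Filter.EventuallyConst s (ae (cantorHaar E)) := by
  have hinv : ∀ N g, MeasurePreserving (diagPerm E N g) ((cantorHaar E).restrict s)
      ((cantorHaar E).restrict s) := fun N g => by
    have := (measurePreserving_diagPerm (E := E) N g).restrict_preimage hs
    rwa [Measure.restrict_congr_set (h N g)] at this
  have key := measure_smul_eq_of_diag_invariant hinv (measurePreserving_diagPerm (E := E))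
    (fun e e' he => Measure.absolutelyContinuous_of_le Measure.restrict_le_self
      (cantorHaar_diagonal_eq_zero he)) (fun e e' he => cantorHaar_diagonal_eq_zero he)
  -- The restriction to `s` does not charge `sᶜ`, so proportionality leaves `0 = μ s * μ sᶜ`.
  have hs' := congrArg (fun ν : Measure (E → Cantor) => ν sᶜ) key
  simp only [Measure.smul_apply, measure_univ, smul_eq_mul, one_mul, Measure.restrict_apply_univ,
    Measure.restrict_apply hs.compl, Set.compl_inter_self, measure_empty] at hs'
  rw [Filter.eventuallyConst_set']
  rcases mul_eq_zero.1 hs'.symm with h0 | h0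
  · exact Or.inl (ae_eq_empty.2 h0)
  · exact Or.inr (ae_eq_univ.2 h0)

/-- A map to the Cantor group that is equivariant under the diagonal prefix permutations is
a coordinate projection. -/
theorem exists_ae_eq_coord_of_equivariant (F : (E → Cantor) → Cantor) (hF : Measurable F)
    (h : ∀ N g, ∀ᵐ x ∂cantorHaar E, F (diagPerm E N g x) = prefixPerm N g (F x)) :
    ∃ e, ∀ᵐ x ∂cantorHaar E, F x = x e := by
  have hS : ∀ e, MeasurableSet {x | F x = x e} := fun e =>
    measurableSet_eq_fun hF (measurable_pi_apply e)
  have hSinv : ∀ e N g, diagPerm E N g ⁻¹' {x | F x = x e} =ᵐ[cantorHaar E] {x | F x = x e} := by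
    intro e N g
    refine Filter.eventuallyEq_set.2 ?_
    filter_upwards [h N g] with x hx
    simp [hx]
  set W : Set (E → Cantor) := {x | ∀ e, F x ≠ x e} with hW
  have hWm : MeasurableSet W := by
    have : W = ⋂ e, {x | F x = x e}ᶜ := by
      ext x
      simp [hW]
    rw [this]
    exact MeasurableSet.iInter fun e => (hS e).compl
  have hWinv : ∀ N g, diagPerm E N g ⁻¹' W =ᵐ[cantorHaar E] W := by
    intro N g
    refine Filter.eventuallyEq_set.2 ?_
    filter_upwards [h N g] with x hx
    simp [hx, hW]
  -- With `F x` adjoined as the coordinate `none`, the image of the restriction to `W` is invariant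
  -- and does not charge diagonals, hence is a multiple of Haar. It lives on the graph of `F`, which
  -- is Haar-null, so it vanishes.
  have hW0 : cantorHaar E W = 0 := by
    let H : (E → Cantor) → Option E → Cantor := fun x o => o.elim (F x) x
    have hH : Measurable H := by
      refine measurable_pi_lambda _ fun o => ?_
      cases o with
      | none => exact hF
      | some e => exact measurable_pi_apply e
    set m := ((cantorHaar E).restrict W).map H with hm
    have hfin : IsFiniteMeasure m := Measure.isFiniteMeasure_map _ _
    have hinv : ∀ N g, MeasurePreserving (diagPerm (Option E) N g) m m := by
      intro N g
      refine ⟨measurable_diagPerm N g, ?_⟩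
      have hr : MeasurePreserving (diagPerm E N g) ((cantorHaar E).restrict W)
          ((cantorHaar E).restrict W) := by
        have := (measurePreserving_diagPerm (E := E) N g).restrict_preimage hWm
        rwa [Measure.restrict_congr_set (hWinv N g)] at this
      rw [hm, Measure.map_map (measurable_diagPerm N g) hH]
      conv_rhs => rw [← hr.map_eq, Measure.map_map hH (measurable_diagPerm N g)]
      refine Measure.map_congr (ae_restrict_of_ae ?_)
      filter_upwards [h N g] with x hx
      funext o
      cases o with
      | none => exact hx.symm
      | some e => rfl
    have hd : ∀ o o', o ≠ o' → m {x | x o = x o'} = 0 := by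
      intro o o' hoo
      rw [hm, Measure.map_apply hH
        (measurableSet_eq_fun (measurable_pi_apply o) (measurable_pi_apply o'))]
      refine measure_eq_zero_iff_ae_notMem.2 ?_
      match o, o', hoo with
      | none, none, hoo => exact absurd rfl hoo
      | none, some e, _ =>
        filter_upwards [ae_restrict_mem hWm] with x hx using hx e
      | some e, none, _ =>
        filter_upwards [ae_restrict_mem hWm] with x hx using fun h' => hx e h'.symm
      | some e, some e', hoo =>
        refine ae_restrict_of_ae (measure_eq_zero_iff_ae_notMem.1 ?_)
        exact cantorHaar_diagonal_eq_zero fun h' => hoo (congrArg some h')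
    have key := measure_smul_eq_of_diag_invariant hinv (measurePreserving_diagPerm (E := Option E))
      hd fun e e' he => cantorHaar_diagonal_eq_zero he
    let Gr : Set (Option E → Cantor) := {y | y none = F fun e => y (some e)}
    have hsome : Measurable fun (y : Option E → Cantor) (e : E) => y (some e) :=
      measurable_pi_lambda _ fun e => measurable_pi_apply _
    have hGr : MeasurableSet Gr :=
      measurableSet_eq_fun (measurable_pi_apply none) (hF.comp hsome)
    have h0 : cantorHaar (Option E) Gr = 0 := by
      refine cantorHaar_graph_eq_zero none _ (hF.comp hsome) fun x y hxy => ?_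
      exact congrArg F (funext fun e => hxy (some e) (by simp))
    have h1 : m Gr = cantorHaar E W := by
      rw [hm, Measure.map_apply hH hGr]
      have : H ⁻¹' Gr = Set.univ := Set.eq_univ_of_forall fun x => rfl
      rw [this, Measure.restrict_apply_univ]
    have h2 := congrArg (fun ν : Measure (Option E → Cantor) => ν Gr) key
    simpa [h0, h1] using h2
  have hex : ∃ e, cantorHaar E {x | F x = x e} ≠ 0 := by
    by_contra! hall
    have : ∀ᵐ x ∂cantorHaar E, False := by
      filter_upwards [measure_eq_zero_iff_ae_notMem.1 hW0,
        ae_all_iff.2 fun e => measure_eq_zero_iff_ae_notMem.1 (hall e)] with x hx hx'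
      exact hx hx'
    simpa using this.exists
  obtain ⟨e, he⟩ := hex
  refine ⟨e, ?_⟩
  have := eventuallyConst_of_diagPerm_invariant (hS e) (hSinv e)
  rw [Filter.eventuallyConst_set'] at this
  rcases this with h0 | h1
  · exact absurd (ae_eq_empty.1 h0) he
  · exact Filter.eventuallyEq_univ.1 h1

end CantorHaar

/-! ### The Polish group `S_∞`. -/

section SInftyTopology

theorem SInfty.continuous_apply (n : ℕ) : Continuous fun σ : SInfty => σ n :=
  (_root_.continuous_apply n).comp continuous_induced_dom

theorem SInfty.continuous_iff {Y : Type*} [TopologicalSpace Y] {f : Y → SInfty} :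
    Continuous f ↔ ∀ n, Continuous fun y => f y n :=
  continuous_induced_rng.trans continuous_pi_iff

theorem SInfty.continuous_inv_apply (n : ℕ) : Continuous fun σ : SInfty => σ⁻¹ n := by
  refine continuous_discrete_rng.2 fun m => ?_
  have : (fun σ : SInfty => σ⁻¹ n) ⁻¹' {m} = (fun σ : SInfty => σ m) ⁻¹' {n} := by
    ext σ
    exact (Equiv.symm_apply_eq σ).trans eq_comm
  rw [this]
  exact (isOpen_discrete _).preimage (SInfty.continuous_apply m)

instance SInfty.instIsTopologicalGroup : IsTopologicalGroup SInfty where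
  continuous_mul := by
    refine SInfty.continuous_iff.2 fun n => continuous_discrete_rng.2 fun k => ?_
    have : (fun p : SInfty × SInfty => (p.1 * p.2) n) ⁻¹' {k} =
        ⋃ m, {p | p.2 n = m} ∩ {p | p.1 m = k} := by
      ext p
      simp
    rw [this]
    exact isOpen_iUnion fun m =>
      ((isOpen_discrete {m}).preimage ((SInfty.continuous_apply n).comp continuous_snd)).inter
        ((isOpen_discrete {k}).preimage ((SInfty.continuous_apply m).comp continuous_fst))
  continuous_inv := SInfty.continuous_iff.2 SInfty.continuous_inv_apply

/-- Pointwise limits of permutations need not be surjective, so the inverse is recorded as well: the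
pairs `(σ, σ⁻¹)` form a closed set. -/
instance SInfty.instPolishSpace : PolishSpace SInfty := by
  let f : SInfty → (ℕ → ℕ) × (ℕ → ℕ) := fun σ => (fun n => σ n, fun n => σ⁻¹ n)
  have hf : Continuous f := (continuous_pi SInfty.continuous_apply).prodMk
    (continuous_pi SInfty.continuous_inv_apply)
  have hind : Topology.IsInducing f :=
    Topology.IsInducing.of_comp hf continuous_fst (Topology.IsInducing.mk rfl)
  have hinj : Function.Injective f := fun σ τ h =>
    Equiv.ext fun n => congrFun (congrArg Prod.fst h) n
  have hrange : Set.range f =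
      ⋂ n : ℕ, {p | p.1 (p.2 n) = n} ∩ {p | p.2 (p.1 n) = n} := by
    ext p
    simp only [Set.mem_range, Set.mem_iInter, Set.mem_inter_iff, Set.mem_ofPred_eq]
    constructor
    · rintro ⟨σ, rfl⟩ n
      simp [f]
    · intro h
      exact ⟨⟨p.1, p.2, fun n => (h n).2, fun n => (h n).1⟩, rfl⟩
  have hev : ∀ n k : ℕ, ∀ u v : (ℕ → ℕ) × (ℕ → ℕ) → ℕ → ℕ, Continuous u → Continuous v →
      IsClosed {p | u p (v p n) = k} := by
    intro n k u v hu hv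
    refine isClosed_singleton.preimage (f := fun p => u p (v p n)) ?_
    have : Continuous fun q : (ℕ → ℕ) × ℕ => q.1 q.2 :=
      continuous_prod_of_discrete_right.2 fun m => _root_.continuous_apply m
    exact this.comp (hu.prodMk ((_root_.continuous_apply n).comp hv))
  have hclosed : IsClosed (Set.range f) := by
    rw [hrange]
    exact isClosed_iInter fun n => (hev n n _ _ continuous_fst continuous_snd).inter
      (hev n n _ _ continuous_snd continuous_fst)
  exact (Topology.IsClosedEmbedding.mk ⟨hind, hinj⟩ hclosed).polishSpace

/-- A permutation that agrees with elements of a closed subgroup on all finite lists lies in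
the subgroup. -/
theorem SInfty.mem_of_forall_list {G : Subgroup SInfty} (hG : IsClosed (G : Set SInfty))
    (σ : SInfty) (h : ∀ s : List ℕ, ∃ g ∈ G, s.map g = s.map σ) : σ ∈ G := by
  choose g hgG hg using fun n => h (List.range n)
  refine hG.mem_of_tendsto (f := g) (b := Filter.atTop) ?_ (Filter.Eventually.of_forall hgG)
  refine (nhds_induced (fun (τ : SInfty) (n : ℕ) => τ n) σ).symm ▸
    Filter.tendsto_comap_iff.2 (tendsto_pi_nhds.2 fun k => tendsto_const_nhds.congr' ?_)
  filter_upwards [Filter.eventually_gt_atTop k] with n hn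
  exact (List.map_inj_left.1 (hg n) k (List.mem_range.2 hn)).symm

end SInftyTopology

/-! ### Coordinate permutations, shears, and what commutes with them. -/

section PermAction

variable {J : Type*}

/-- The shear of `J → Cantor` that adds to each coordinate `j` the coordinate `q j`, if any. -/
def shear (q : J → Option J) (hq : ∀ j k, q j = some k → q k = none) :
    Equiv.Perm (J → Cantor) :=
  -- By `hq` the coordinate being added is itself left unchanged; in characteristic 2 adding it
  -- twice does nothing.
  Function.Involutive.toPerm (fun x j => x j + (q j).elim 0 x) (by
    intro x
    funext j
    dsimp only
    cases h : q j with
    | none => simp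
    | some k =>
      simp only [Option.elim_some, hq j k h, Option.elim_none, add_zero]
      funext n
      have : ∀ a b : ZMod 2, a + b + b = a := by decide
      exact this _ _)

@[simp]
theorem shear_apply (q : J → Option J) (hq : ∀ j k, q j = some k → q k = none)
    (x : J → Cantor) (j : J) : shear q hq x j = x j + (q j).elim 0 x := rfl

variable [Countable J]

/-- The permutation of coordinates. -/
def coordPerm (J : Type*) : Equiv.Perm J →* Equiv.Perm (J → Cantor) where
  toFun ρ := ⟨fun x j => x (ρ⁻¹ j), fun x j => x (ρ j), fun x => by simp, fun x => by simp⟩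
  map_one' := rfl
  map_mul' ρ τ := by
    ext x
    simp [mul_inv_rev]

theorem measurePreserving_coordPerm (ρ : Equiv.Perm J) :
    MeasurePreserving (coordPerm J ρ) (cantorHaar J) (cantorHaar J) :=
  measurePreserving_cantorHaar
    { toFun := coordPerm J ρ, map_zero' := rfl, map_add' := fun _ _ => rfl }
    (continuous_pi fun j => continuous_apply (ρ⁻¹ j)) (coordPerm J ρ).surjective

/-- The coordinate permutations as elements of the group of measure preserving bijections. -/
noncomputable def coordMP (J : Type*) [Countable J] : Equiv.Perm J →* mpPerm (cantorHaar J) :=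
  (coordPerm J).codRestrict _ fun ρ => ⟨measurePreserving_coordPerm ρ, by
    have := measurePreserving_coordPerm ρ⁻¹
    rwa [map_inv] at this⟩

/-- The diagonal prefix permutations as measure preserving bijections. -/
noncomputable def diagMP (J : Type*) [Countable J] (N : ℕ) (g : Equiv.Perm (Fin N → ZMod 2)) :
    mpPerm (cantorHaar J) :=
  ⟨diagPerm J N g, measurePreserving_diagPerm N g, measurePreserving_diagPerm N g.symm⟩

theorem measurePreserving_shear (q : J → Option J) (hq : ∀ j k, q j = some k → q k = none) :
    MeasurePreserving (shear q hq) (cantorHaar J) (cantorHaar J) := by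
  refine measurePreserving_cantorHaar
    { toFun := shear q hq
      map_zero' := ?_
      map_add' := fun x y => ?_ } (continuous_pi fun j => ?_) (shear q hq).surjective
  · funext j
    cases h : q j <;> simp [h]
  · funext j
    cases h : q j <;> simp [h, add_add_add_comm]
  · change Continuous fun x : J → Cantor => x j + (q j).elim 0 x
    cases h : q j with
    | none => simpa using continuous_apply j
    | some k => exact (continuous_apply j).add (continuous_apply k)

/-- The shears as measure preserving bijections. -/
noncomputable def shearMP (q : J → Option J) (hq : ∀ j k, q j = some k → q k = none) :
    mpPerm (cantorHaar J) :=
  ⟨shear q hq, measurePreserving_shear q hq, measurePreserving_shear q hq⟩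

theorem commute_coordMP_diagMP (ρ : Equiv.Perm J) (N : ℕ) (g : Equiv.Perm (Fin N → ZMod 2)) :
    Commute (coordMP J ρ) (diagMP J N g) := rfl

theorem commute_coordMP_shearMP {q : J → Option J} (hq : ∀ j k, q j = some k → q k = none)
    {ρ : Equiv.Perm J} (h : ∀ j, q (ρ j) = (q j).map ρ) :
    Commute (coordMP J ρ) (shearMP q hq) := by
  refine Subtype.ext (Equiv.ext fun x => funext fun j => ?_)
  change x (ρ⁻¹ j) + (q (ρ⁻¹ j)).elim 0 x = x (ρ⁻¹ j) + (q j).elim 0 (fun j => x (ρ⁻¹ j))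
  have : q j = (q (ρ⁻¹ j)).map ρ := by rw [← h, show ρ (ρ⁻¹ j) = j from ρ.apply_symm_apply j]
  rw [this]
  cases q (ρ⁻¹ j) <;> simp

/-- An automorphism that commutes with the diagonal prefix permutations is a substitution of
coordinates. -/
theorem exists_ae_eq_comp_of_commute (θ : mpPerm (cantorHaar J))
    (h : ∀ N g, AutMP.mk _ (diagMP J N g) * AutMP.mk _ θ = AutMP.mk _ θ * AutMP.mk _ (diagMP J N g)) :
    ∃ ρ : J → J, ∀ᵐ x ∂cantorHaar J, (θ : Equiv.Perm (J → Cantor)) x = x ∘ ρ := by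
  have key : ∀ j, ∃ i, ∀ᵐ x ∂cantorHaar J, (θ : Equiv.Perm (J → Cantor)) x j = x i := by
    intro j
    refine exists_ae_eq_coord_of_equivariant (fun x => (θ : Equiv.Perm (J → Cantor)) x j)
      ((measurable_pi_apply j).comp θ.2.1.measurable) fun N g => ?_
    have := h N g
    rw [← map_mul, ← map_mul, AutMP.mk_eq_mk_iff] at this
    filter_upwards [this] with x hx
    exact (congrFun hx j).symm
  choose ρ hρ using key
  refine ⟨ρ, ?_⟩
  filter_upwards [ae_all_iff.2 hρ] with x hx
  exact funext hx

/-- Comparing the `j`-th coordinates of the two composites and cancelling `x (ρ j)` equates the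
added terms almost everywhere. A coordinate is neither almost everywhere zero nor equal to another
one, so the indices agree. -/
theorem map_eq_of_commute_shear {q : J → Option J} (hq : ∀ j k, q j = some k → q k = none)
    (θ : mpPerm (cantorHaar J)) {ρ : J → J}
    (hρ : ∀ᵐ x ∂cantorHaar J, (θ : Equiv.Perm (J → Cantor)) x = x ∘ ρ)
    (h : AutMP.mk _ (shearMP q hq) * AutMP.mk _ θ = AutMP.mk _ θ * AutMP.mk _ (shearMP q hq))
    (j : J) : q (ρ j) = (q j).map ρ := by
  rw [← map_mul, ← map_mul, AutMP.mk_eq_mk_iff] at h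
  have h' : ∀ᵐ x ∂cantorHaar J, ((q j).map ρ).elim 0 x = (q (ρ j)).elim 0 x := by
    filter_upwards [h, hρ, (measurePreserving_shear q hq).quasiMeasurePreserving.ae hρ]
      with x h1 h2 h3
    have h4 : shear q hq ((θ : Equiv.Perm (J → Cantor)) x) =
      (θ : Equiv.Perm (J → Cantor)) (shear q hq x) := h1
    rw [h2, h3] at h4
    have h5 := congrFun h4 j
    simp only [shear_apply, Function.comp_apply, add_right_inj] at h5
    rw [← h5]
    cases q j <;> rfl
  cases h1 : q (ρ j) with
  | none =>
    cases h2 : q j with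
    | none => rfl
    | some k => exact absurd (by simpa [h1, h2] using h') (not_ae_coord_eq_zero (ρ k))
  | some i =>
    cases h2 : q j with
    | none =>
      refine absurd ?_ (not_ae_coord_eq_zero i)
      filter_upwards [h'] with x hx
      simpa [h1, h2] using hx.symm
    | some k =>
      have : ρ k = i := eq_of_ae_eq_coord (by simpa [h1, h2] using h')
      simp [this]

end PermAction

/-! ### Recovering a closed permutation group from its orbits on finite lists. -/

section ListStructure

/-- The countable set on which `S_∞` acts: points and finite lists of points. -/
abbrev PointList : Type := ℕ ⊕ List ℕ

/-- The action of `S_∞` on points and finite lists of points. -/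
def pointListPerm : SInfty →* Equiv.Perm PointList where
  toFun σ := ⟨Sum.map σ (List.map σ), Sum.map σ.symm (List.map σ.symm),
    fun j => by cases j <;> simp, fun j => by cases j <;> simp⟩
  map_one' := by
    ext j
    cases j <;> simp
  map_mul' σ τ := by
    ext j
    cases j <;> simp

@[simp]
theorem pointListPerm_inl (σ : SInfty) (n : ℕ) : pointListPerm σ (Sum.inl n) = Sum.inl (σ n) := rfl

@[simp]
theorem pointListPerm_inr (σ : SInfty) (s : List ℕ) :
    pointListPerm σ (Sum.inr s) = Sum.inr (s.map σ) := rfl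

open Classical in
/-- The `l`-th entry of the lists in the `G`-orbit of `t`. -/
noncomputable def orbitEntry (G : Subgroup SInfty) (t : List ℕ) (l : ℕ) :
    PointList → Option PointList
  | Sum.inl _ => none
  | Sum.inr s => if ∃ g ∈ G, t.map g = s then (s[l]?).map Sum.inl else none

variable {G : Subgroup SInfty}

theorem orbitEntry_orbitEntry (t : List ℕ) (l : ℕ) (j k : PointList)
    (h : orbitEntry G t l j = some k) : orbitEntry G t l k = none := by
  cases k with
  | inl n => rfl
  | inr s =>
    cases j with
    | inl n => simp [orbitEntry] at h
    | inr s' =>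
      rw [orbitEntry] at h
      split_ifs at h
      simp at h

theorem orbitEntry_pointListPerm {σ : SInfty} (hσ : σ ∈ G) (t : List ℕ) (l : ℕ)
    (j : PointList) :
    orbitEntry G t l (pointListPerm σ j) = (orbitEntry G t l j).map (pointListPerm σ) := by
  cases j with
  | inl n => rfl
  | inr s =>
    have : (∃ g ∈ G, t.map g = s.map σ) ↔ ∃ g ∈ G, t.map g = s := by
      constructor
      · rintro ⟨g, hg, h⟩
        refine ⟨σ⁻¹ * g, G.mul_mem (G.inv_mem hσ) hg, ?_⟩
        have := congrArg (List.map (σ⁻¹ : SInfty)) h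
        simpa using this
      · rintro ⟨g, hg, rfl⟩
        exact ⟨σ * g, G.mul_mem hσ hg, by simp⟩
    rw [pointListPerm_inr, orbitEntry, orbitEntry]
    by_cases hs : ∃ g ∈ G, t.map g = s
    · rw [if_pos (this.2 hs), if_pos hs]
      cases h : s[l]? <;> simp [h]
    · rw [if_neg (mt this.1 hs), if_neg hs]
      rfl

theorem exists_of_orbitEntry_eq_some {t : List ℕ} {l : ℕ} {j k : PointList}
    (h : orbitEntry G t l j = some k) :
    ∃ g ∈ G, j = Sum.inr (t.map g) ∧ (t[l]?).map (fun n => Sum.inl (g n)) = some k := by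
  cases j with
  | inl n => simp [orbitEntry] at h
  | inr s =>
    rw [orbitEntry] at h
    split_ifs at h with hs
    obtain ⟨g, hg, rfl⟩ := hs
    refine ⟨g, hg, rfl, ?_⟩
    rw [← h, List.getElem?_map, Option.map_map]
    rfl

theorem orbitEntry_self (t : List ℕ) (l : ℕ) :
    orbitEntry G t l (Sum.inr t) = (t[l]?).map Sum.inl := by
  rw [orbitEntry, if_pos ⟨1, G.one_mem, by simp⟩]

/-- A map commuting with the entries of lists in orbits comes from a map on points, which on each
list agrees with an element of the group. -/
theorem exists_map_of_commute_orbitEntry {ρ : PointList → PointList}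
    (h : ∀ t l j, orbitEntry G t l (ρ j) = (orbitEntry G t l j).map ρ) :
    ∃ σ : ℕ → ℕ, (∀ n, ρ (Sum.inl n) = Sum.inl (σ n)) ∧
      ∀ s : List ℕ, s ≠ [] → ρ (Sum.inr s) = Sum.inr (s.map σ) ∧
        ∃ g ∈ G, s.map g = s.map σ := by
  have hone : ∀ n, ∃ m, ρ (Sum.inl n) = Sum.inl m := by
    intro n
    -- The point `n` is an entry of the list `[n]`, and entries are always points, so `ρ` sends
    -- points to points.
    have h1 := h [n] 0 (Sum.inr [n])
    rw [orbitEntry_self] at h1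
    obtain ⟨g, _, _, h2⟩ := exists_of_orbitEntry_eq_some (k := ρ (Sum.inl n)) (by simpa using h1)
    exact ⟨g n, by simpa using h2.symm⟩
  choose σ hσ using hone
  refine ⟨σ, hσ, fun s hs => ?_⟩
  have hl : ∀ l (hl : l < s.length), ∃ g ∈ G, ρ (Sum.inr s) = Sum.inr (s.map g) ∧
      g s[l] = σ s[l] := by
    intro l hl
    have h1 := h s l (Sum.inr s)
    rw [orbitEntry_self] at h1
    obtain ⟨g, hg, h2, h3⟩ := exists_of_orbitEntry_eq_some (k := ρ (Sum.inl s[l]))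
      (by simpa [hl] using h1)
    refine ⟨g, hg, h2, ?_⟩
    rw [hσ] at h3
    simpa [hl] using h3
  -- The `g` supplied by `hl` may vary with `l`, but `s.map g` does not, being determined by the
  -- image of `s`; one `g` therefore serves all entries.
  obtain ⟨g, hg, h2, _⟩ := hl 0 (List.length_pos_iff.2 hs)
  have hmap : s.map g = s.map σ := by
    refine List.ext_getElem (by simp) fun l h1 _ => ?_
    have hls : l < s.length := by simpa using h1
    obtain ⟨g', _, h3, h4⟩ := hl l hls
    rw [h2] at h3
    have h5 : s.map g = s.map g' := Sum.inr_injective h3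
    have h6 : g s[l] = g' s[l] := List.map_inj_left.1 h5 _ (List.getElem_mem hls)
    simp [h6, h4]
  exact ⟨by rw [h2, hmap], g, hg, hmap⟩

/-- A bijection commuting with the entries of lists in orbits comes from an element of the
group, if the group is closed. -/
theorem exists_mem_of_commute_orbitEntry (hG : IsClosed (G : Set SInfty))
    {ρ ρ' : PointList → PointList} (hρρ' : ∀ j, ρ (ρ' j) = j) (hρ'ρ : ∀ j, ρ' (ρ j) = j)
    (h : ∀ t l j, orbitEntry G t l (ρ j) = (orbitEntry G t l j).map ρ)
    (h' : ∀ t l j, orbitEntry G t l (ρ' j) = (orbitEntry G t l j).map ρ') :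
    ∃ σ ∈ G, ∀ j, ρ j = pointListPerm σ j := by
  obtain ⟨σ, hσ, hσl⟩ := exists_map_of_commute_orbitEntry h
  obtain ⟨σ', hσ', hσl'⟩ := exists_map_of_commute_orbitEntry h'
  let τ : SInfty := ⟨σ, σ',
    fun n => by simpa [hσ, hσ'] using hρ'ρ (Sum.inl n),
    fun n => by simpa [hσ, hσ'] using hρρ' (Sum.inl n)⟩
  refine ⟨τ, SInfty.mem_of_forall_list hG τ fun s => ?_, fun j => ?_⟩
  · by_cases hs : s = []
    · exact ⟨1, G.one_mem, by simp [hs]⟩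
    · exact (hσl s hs).2
  · cases j with
    | inl n => exact hσ n
    | inr s =>
      -- The empty list has no entries, so the shears say nothing about it. It is fixed by
      -- elimination: `ρ'` sends points to points and nonempty lists to nonempty lists.
      by_cases hs : s = []
      · subst hs
        cases hj : ρ (Sum.inr []) with
        | inl m =>
          have := hρ'ρ (Sum.inr [])
          rw [hj, hσ'] at this
          exact absurd this (by simp)
        | inr s =>
          by_cases hs : s = []
          · simp [hs]
          · have := hρ'ρ (Sum.inr [])
            rw [hj, (hσl' s hs).1] at this
            exact absurd this (by simpa using hs)
      · exact (hσl s hs).1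

end ListStructure

/-! ### The acting group and the algebraic isomorphism of `G` with its centralizer. -/

section Generators

/-- The index set of the generators of the acting group. -/
abbrev GeneratorIndex : Type := (Σ N : ℕ, Equiv.Perm (Fin N → ZMod 2)) ⊕ (List ℕ × ℕ)

/-- The generators of the acting group. -/
noncomputable def generator (G : Subgroup SInfty) :
    GeneratorIndex → mpPerm (cantorHaar PointList)
  | Sum.inl ⟨N, g⟩ => diagMP PointList N g
  | Sum.inr ⟨t, l⟩ => shearMP (orbitEntry G t l) (orbitEntry_orbitEntry t l)

/-- The countable acting group whose centralizer is `G`. -/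
noncomputable def actingGroup (G : Subgroup SInfty) : Subgroup (mpPerm (cantorHaar PointList)) :=
  (FreeGroup.lift (generator G)).range

instance (G : Subgroup SInfty) : Countable (actingGroup G) :=
  (Set.countable_range (FreeGroup.lift (generator G))).to_subtype

theorem generator_mem (G : Subgroup SInfty) (i : GeneratorIndex) : generator G i ∈ actingGroup G :=
  ⟨FreeGroup.of i, by simp⟩

instance (G : Subgroup SInfty) : MeasurableConstSMul (actingGroup G) (PointList → Cantor) :=
  ⟨fun c => c.1.2.1.measurable⟩

/-- The diagonal prefix permutations alone already act ergodically. -/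
instance (G : Subgroup SInfty) :
    ErgodicSMul (actingGroup G) (PointList → Cantor) (cantorHaar PointList) where
  measure_preimage_smul c _ hs := c.1.2.1.measure_preimage hs.nullMeasurableSet
  aeconst_of_forall_preimage_smul_ae_eq hs h :=
    eventuallyConst_of_diagPerm_invariant hs fun N g =>
      h ⟨_, generator_mem G (Sum.inl ⟨N, g⟩)⟩

theorem commute_coordMP_of_mem {G : Subgroup SInfty} {σ : SInfty} (hσ : σ ∈ G)
    {a : mpPerm (cantorHaar PointList)} (ha : a ∈ actingGroup G) :
    Commute (coordMP PointList (pointListPerm σ)) a := by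
  have hle : actingGroup G ≤ Subgroup.centralizer {coordMP PointList (pointListPerm σ)} := by
    refine FreeGroup.range_lift_le ?_
    rintro _ ⟨i, rfl⟩
    refine Subgroup.mem_centralizer_singleton_iff.2 ?_
    match i with
    | Sum.inl ⟨N, g⟩ => exact (commute_coordMP_diagMP _ N g).eq.symm
    | Sum.inr ⟨t, l⟩ =>
      exact (commute_coordMP_shearMP _ (orbitEntry_pointListPerm hσ t l)).eq.symm
  exact (Subgroup.mem_centralizer_singleton_iff.1 (hle ha)).symm

/-- The centralizer of the acting group. -/
noncomputable abbrev actingCentralizer (G : Subgroup SInfty) :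
    Subgroup (AutMP (cantorHaar PointList)) :=
  Subgroup.centralizer ((AutMP.ofAction (actingGroup G) (cantorHaar PointList)).range :
    Set (AutMP (cantorHaar PointList)))

/-- The action of `G` by coordinate permutations, as a map to the centralizer. -/
noncomputable def toCentralizer (G : Subgroup SInfty) : G →* actingCentralizer G :=
  ((AutMP.mk _).comp ((coordMP PointList).comp (pointListPerm.comp G.subtype))).codRestrict _ (by
    rintro σ _ ⟨a, rfl⟩
    have := (commute_coordMP_of_mem σ.2 a.2).eq.symm
    exact congrArg (AutMP.mk _) this)

theorem toCentralizer_injective (G : Subgroup SInfty) : Function.Injective (toCentralizer G) := by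
  intro σ τ h
  have h' := (AutMP.mk_eq_mk_iff _ _ _).1 (congrArg Subtype.val h)
  -- Coordinates are permuted by precomposition with the inverse, so it is the inverses that are
  -- read off.
  refine inv_injective (Subtype.ext (Equiv.ext fun n => ?_))
  have : (Sum.inl ((σ⁻¹ : G).1 n) : PointList) = Sum.inl ((τ⁻¹ : G).1 n) := by
    refine eq_of_ae_eq_coord ?_
    filter_upwards [h'] with x hx
    exact congrFun hx (Sum.inl n)
  exact Sum.inl_injective this

theorem mk_commute_of_mem_actingCentralizer {G : Subgroup SInfty}
    {θ : mpPerm (cantorHaar PointList)} (hθ : AutMP.mk _ θ ∈ actingCentralizer G)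
    (i : GeneratorIndex) :
    AutMP.mk _ (generator G i) * AutMP.mk _ θ = AutMP.mk _ θ * AutMP.mk _ (generator G i) :=
  hθ _ ⟨⟨_, generator_mem G i⟩, rfl⟩

theorem toCentralizer_surjective {G : Subgroup SInfty} (hG : IsClosed (G : Set SInfty)) :
    Function.Surjective (toCentralizer G) := by
  rintro ⟨c, hc⟩
  obtain ⟨θ, rfl⟩ := QuotientGroup.mk'_surjective _ c
  change AutMP.mk _ θ ∈ actingCentralizer G at hc
  have hc' : AutMP.mk _ θ⁻¹ ∈ actingCentralizer G := by
    rw [map_inv]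
    exact inv_mem hc
  have hcoord : ∀ θ : mpPerm (cantorHaar PointList), AutMP.mk _ θ ∈ actingCentralizer G →
      ∃ ρ : PointList → PointList,
        (∀ᵐ x ∂cantorHaar PointList, (θ : Equiv.Perm (PointList → Cantor)) x = x ∘ ρ) ∧
        ∀ t l j, orbitEntry G t l (ρ j) = (orbitEntry G t l j).map ρ := by
    intro θ hθ
    obtain ⟨ρ, hρ⟩ := exists_ae_eq_comp_of_commute θ fun N g =>
      mk_commute_of_mem_actingCentralizer hθ (Sum.inl ⟨N, g⟩)
    exact ⟨ρ, hρ, fun t l j => map_eq_of_commute_shear _ θ hρ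
      (mk_commute_of_mem_actingCentralizer hθ (Sum.inr ⟨t, l⟩)) j⟩
  obtain ⟨ρ, hρ, hρe⟩ := hcoord θ hc
  obtain ⟨ρ', hρ', hρe'⟩ := hcoord θ⁻¹ hc'
  -- The substitutions for `θ` and `θ⁻¹` compose to the identity almost everywhere, hence on
  -- indices.
  have h1 : ∀ j, ρ' (ρ j) = j := fun j => by
    refine eq_of_ae_eq_coord ?_
    filter_upwards [hρ', θ.2.2.quasiMeasurePreserving.ae hρ] with x hx hx'
    have h : x = (x ∘ ρ') ∘ ρ := by
      rw [← hx]
      refine Eq.trans ?_ hx'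
      exact ((θ : Equiv.Perm (PointList → Cantor)).apply_symm_apply x).symm
    exact (congrFun h j).symm
  have h2 : ∀ j, ρ (ρ' j) = j := fun j => by
    refine eq_of_ae_eq_coord ?_
    filter_upwards [hρ, θ.2.1.quasiMeasurePreserving.ae hρ'] with x hx hx'
    have h : x = (x ∘ ρ) ∘ ρ' := by
      rw [← hx]
      refine Eq.trans ?_ hx'
      exact ((θ : Equiv.Perm (PointList → Cantor)).symm_apply_apply x).symm
    exact (congrFun h j).symm
  obtain ⟨σ, hσG, hσ⟩ := exists_mem_of_commute_orbitEntry hG h2 h1 hρe hρe'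
  -- Since `θ` is `x ↦ x ∘ ρ` while `σ` acts by `x ↦ x ∘ σ⁻¹`, the preimage is the inverse.
  refine ⟨⟨σ, hσG⟩⁻¹, Subtype.ext ?_⟩
  refine (AutMP.mk_eq_mk_iff _ _ _).2 ?_
  filter_upwards [hρ] with x hx
  rw [hx]
  funext j
  change x ((pointListPerm σ⁻¹)⁻¹ j) = x (ρ j)
  rw [hσ, map_inv, inv_inv]

end Generators

/-! ### The isomorphism is a homeomorphism. -/

section CentralizerTopology

instance {E : Type*} [Countable E] : (cantorHaar E).Regular :=
  inferInstanceAs (Measure.addHaarMeasure ⊤).Regular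

theorem AutMP.continuous_measureSymmDiff {X : Type*} [MeasurableSpace X] (μ : Measure X)
    {A B : Set X} (hA : MeasurableSet A) (hB : MeasurableSet B) :
    Continuous (AutMP.measureSymmDiff μ A B) :=
  continuous_iInf_dom (i := ⟨A, hA⟩) (continuous_iInf_dom (i := ⟨B, hB⟩) continuous_induced_dom)

theorem eventually_pointListPerm_eq (σ : SInfty) (j : PointList) :
    ∀ᶠ τ in nhds σ, pointListPerm τ j = pointListPerm σ j := by
  have hpt : ∀ n, ∀ᶠ τ : SInfty in nhds σ, τ n = σ n := fun n =>
    (SInfty.continuous_apply n).continuousAt.eventually_mem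
      ((isOpen_discrete {σ n}).mem_nhds rfl)
  cases j with
  | inl n =>
    filter_upwards [hpt n] with τ hτ
    simp [hτ]
  | inr s =>
    have : ∀ᶠ τ : SInfty in nhds σ, ∀ n ∈ s, τ n = σ n := by
      have := (Filter.eventually_all_finset s.toFinset).2 fun n _ => hpt n
      simpa using this
    filter_upwards [this] with τ hτ
    rw [pointListPerm_inr, pointListPerm_inr, List.map_congr_left hτ]

theorem continuous_coordPerm_uncurry :
    Continuous fun p : SInfty × (PointList → Cantor) =>
      coordPerm PointList (pointListPerm p.1) p.2 := by
  refine continuous_pi fun j => continuous_iff_continuousAt.2 fun p => ?_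
  have h : (fun q : SInfty × (PointList → Cantor) => q.2 ((pointListPerm p.1)⁻¹ j)) =ᶠ[nhds p]
      fun q => coordPerm PointList (pointListPerm q.1) q.2 j := by
    have h1 := ((continuous_inv.comp continuous_fst).tendsto p).eventually
      (eventually_pointListPerm_eq p.1⁻¹ j)
    filter_upwards [h1] with q hq
    change q.2 ((pointListPerm p.1)⁻¹ j) = q.2 ((pointListPerm q.1)⁻¹ j)
    rw [← map_inv, ← map_inv]
    exact congrArg q.2 hq.symm
  exact ((continuous_apply _).comp continuous_snd).continuousAt.congr h

/-- Joint continuity makes `σ ↦ f σ` continuous for the compact-open topology; for measure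
preserving maps and a regular measure this forces preimages of `A` to converge in measure. -/
theorem continuous_measure_symmDiff_coordPerm {A : Set (PointList → Cantor)}
    (hA : MeasurableSet A) (B : Set (PointList → Cantor)) :
    Continuous fun σ : SInfty =>
      cantorHaar PointList ((coordPerm PointList (pointListPerm σ) ⁻¹' A) ∆ B) := by
  let f : C(SInfty, C(PointList → Cantor, PointList → Cantor)) :=
    ContinuousMap.curry ⟨_, continuous_coordPerm_uncurry⟩
  have hf : ∀ σ, MeasurePreserving (f σ) (cantorHaar PointList) (cantorHaar PointList) :=
    fun σ => measurePreserving_coordPerm (pointListPerm σ)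
  refine continuous_iff_continuousAt.2 fun σ => ?_
  have h := tendsto_measure_symmDiff_preimage_nhds_zero (f.continuous.tendsto σ)
    (Filter.Eventually.of_forall hf) (hf σ) hA.nullMeasurableSet (measure_ne_top _ A)
  refine (ENNReal.tendsto_nhds (measure_ne_top _ _)).2 fun ε hε => ?_
  filter_upwards [ENNReal.tendsto_nhds_zero.1 h ε hε] with τ hτ
  constructor
  · rw [tsub_le_iff_right, add_comm]
    refine (measure_symmDiff_le _ (f τ ⁻¹' A) _).trans (add_le_add_left ?_ _)
    rwa [symmDiff_comm]
  · rw [add_comm]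
    exact (measure_symmDiff_le _ (f σ ⁻¹' A) _).trans (add_le_add_left hτ _)

theorem continuous_toCentralizer (G : Subgroup SInfty) : Continuous (toCentralizer G) := by
  refine continuous_induced_rng.2 (continuous_iInf_rng.2 fun A => continuous_iInf_rng.2 fun B =>
    continuous_induced_rng.2 ?_)
  exact (continuous_measure_symmDiff_coordPerm A.2 B.1).comp continuous_subtype_val

/-- The set of points whose coordinate `e` starts with the digit `0`. -/
def zeroDigit {E : Type*} (e : E) : Set (E → Cantor) := {x | x e 0 = 0}

theorem measurableSet_zeroDigit {E : Type*} (e : E) : MeasurableSet (zeroDigit e) :=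
  measurableSet_eq_fun ((measurable_pi_apply 0).comp (measurable_pi_apply e)) measurable_const

/-- For `e ≠ e'`, flipping digit `0` of coordinate `e` exchanges the symmetric difference with its
complement, so its mass is exactly `1 / 2`. -/
theorem cantorHaar_zeroDigit_symmDiff_lt {E : Type*} [Countable E] {e e' : E} :
    cantorHaar E (zeroDigit e ∆ zeroDigit e') < 1 / 2 ↔ e = e' := by
  classical
  refine ⟨fun h => ?_, fun h => by simp [h]⟩
  by_contra hne
  set D := zeroDigit e ∆ zeroDigit e' with hD
  have hDm : MeasurableSet D := (measurableSet_zeroDigit e).symmDiff (measurableSet_zeroDigit e')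
  let t : E → Cantor := Pi.single e (Pi.single 0 1)
  have ht : (fun x => t + x) ⁻¹' D = Dᶜ := by
    ext x
    have key : ∀ a b : ZMod 2, ((1 + a = 0 ∧ ¬ b = 0) ∨ (b = 0 ∧ ¬ 1 + a = 0)) ↔
        (a = 0 ↔ b = 0) := by decide
    simpa [hD, t, zeroDigit, Set.mem_symmDiff, Ne.symm hne] using key (x e 0) (x e' 0)
  have h1 := measure_preimage_add (cantorHaar E) t D
  rw [ht] at h1
  have h2 := measure_add_measure_compl (μ := cantorHaar E) hDm
  rw [h1, measure_univ] at h2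
  have h3 := ENNReal.add_lt_add h h
  rw [h2, ENNReal.add_halves] at h3
  exact lt_irrefl _ h3

/-- The condition `σ n = m` is equivalent to a strict inequality on one of the functions defining
the weak topology, hence open. -/
theorem continuous_symm_of_eq_toCentralizer {G : Subgroup SInfty}
    (e : G ≃* actingCentralizer G) (he : ∀ σ, e σ = toCentralizer G σ) :
    Continuous e.symm := by
  refine continuous_induced_rng.2 (SInfty.continuous_iff.2 fun n => continuous_discrete_rng.2
    fun m => ?_)
  have hset : (fun c => (e.symm c : SInfty) n) ⁻¹' {m} =
      {c | AutMP.measureSymmDiff (cantorHaar PointList) (zeroDigit (Sum.inl m))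
        (zeroDigit (Sum.inl n)) c.1 < 1 / 2} := by
    ext c
    obtain ⟨σ, rfl⟩ := e.surjective c
    have h1 : AutMP.measureSymmDiff (cantorHaar PointList) (zeroDigit (Sum.inl m))
        (zeroDigit (Sum.inl n)) (e σ).1 = cantorHaar PointList
          (zeroDigit (Sum.inl ((σ : SInfty)⁻¹ m)) ∆ zeroDigit (Sum.inl n)) := by
      rw [he]
      rfl
    simp only [Set.mem_preimage, Set.mem_singleton_iff, Set.mem_ofPred_eq, h1,
      MulEquiv.symm_apply_apply, cantorHaar_zeroDigit_symmDiff_lt, Sum.inl.injEq]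
    exact eq_comm.trans (Equiv.symm_apply_eq (σ : SInfty)).symm
  refine hset ▸ isOpen_lt ((AutMP.continuous_measureSymmDiff _ (measurableSet_zeroDigit _)
    (measurableSet_zeroDigit _)).comp continuous_subtype_val) continuous_const

end CentralizerTopology

theorem mainTheorem3 (G : Subgroup SInfty) (hG : IsClosed (G : Set SInfty)) :
    IsCentralizerGroup G := by
  have : PolishSpace G := hG.polishSpace
  let e : G ≃* actingCentralizer G :=
    MulEquiv.ofBijective (toCentralizer G) ⟨toCentralizer_injective G, toCentralizer_surjective hG⟩
  exact ⟨inferInstance, this, PointList → Cantor, inferInstance, inferInstance,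
    cantorHaar PointList, inferInstance, actingGroup G, inferInstance, inferInstance,
    inferInstance, inferInstance, inferInstance,
    ⟨{ e with
      continuous_toFun := continuous_toCentralizer G
      continuous_invFun := continuous_symm_of_eq_toCentralizer e fun _ => rfl }⟩⟩
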